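/- **Online $b$-matching.** Let $k,d,b$ be integers with $k\ge d\ge 2$ and $b\ge 1$. An input is a finite bipartite graph $G=(S\cup R,E)$ together with an ordering of $R$. The servers $S$ are known in advance. The requests $r\in R$ arrive one by one in the given order, and the neighbourhood of $r$ in $S$ is revealed when $r$ arrives. A $b$-matching is a set of edges containing at most $b$ edges at every server and at most one edge at every request. The graph $G$ is a $(k,d)$-graph (for the uniform server capacity $b$) if every server has degree at least $kb$ and every request has degree at most $d$. A deterministic online algorithm decides, on the arrival of each request, immediately and irrevocably whether and to which adjacent server to match it. The decision is a function of $S$, the neighbourhoods of the requests that have arrived so far (in their order of arrival) and the neighbourhood of the new request, and the constructed set of edges must be a $b$-matching on every $(k,d)$-graph. Let $\mathrm{Alg}(G)$ be the size of the $b$-matching constructed by the algorithm and $\mathrm{Opt}(G)$ the maximum size of a $b$-matching in $G$. For $c\in\mathbb{R}$, the algorithm is $c$-competitive on $(k,d)$-graphs if $\mathrm{Alg}(G)\ge c\cdot \mathrm{Opt}(G)$ for all $(k,d)$-graphs $G$ and all arrival orders. **Theorem.** Let $$c^* = 1-\frac1b\left(\sum_{i=1}^{b} i\binom{kb}{b-i}\frac{1}{(d-1)^{b-i}}\right)\left(1-\frac1d\right)^{kb}.$$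 No deterministic online algorithm for the $b$-matching problem with uniform server capacity $b$ has a competitive ratio better than $c^*$ on $(k,d)$-graphs: if such an algorithm is $c$-competitive on $(k,d)$-graphs, then $c\le c^*$. -/

import Mathlib

namespace OnlineBMatching

/-- An input of the online problem: a finite bipartite graph together with the arrival order of its
requests. The servers are the elements of `Fin numServers`, known in advance. The requests
arrive one by one, in the order of the list `arrivals`; each request is given by its set of
neighbouring servers. The vertex set of requests is `Fin arrivals.length`. -/
structure Input where
  numServers : ℕ
  arrivals : List (Finset (Fin numServers))

namespace Input

/-- The servers of the graph. -/
abbrev Server (G : Input) : Type := Fin G.numServers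

/-- The requests of the graph, numbered in their order of arrival. -/
abbrev Request (G : Input) : Type := Fin G.arrivals.length

/-- The neighbours of a request. -/
def nbr (G : Input) (r : G.Request) : Finset G.Server := G.arrivals.get r

/-- The degree of a server: the number of requests adjacent to it. -/
def serverDegree (G : Input) (s : G.Server) : ℕ :=
  (Finset.univ.filter fun r : G.Request => s ∈ G.nbr r).card

/-- `(k,d)`-graphs for uniform server capacity `b`: every server has degree at least `k * b`, and
every request has degree at most `d`. -/
def IsKDGraph (G : Input) (k d b : ℕ) : Prop :=
  (∀ s : G.Server, k * b ≤ G.serverDegree s) ∧ ∀ r : G.Request, (G.nbr r).card ≤ d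

/-- An assignment sends each request to a server or leaves it unmatched (`none`). -/
abbrev Assignment (G : Input) : Type := G.Request → Option G.Server

/-- The load of a server in an assignment: the number of requests assigned to it. -/
def load (G : Input) (M : G.Assignment) (s : G.Server) : ℕ :=
  (Finset.univ.filter fun r : G.Request => M r = some s).card

/-- The size of an assignment: the number of requests that are matched. -/
def size (G : Input) (M : G.Assignment) : ℕ :=
  (Finset.univ.filter fun r : G.Request => M r ≠ none).card

/-- `b`-matchings: requests are assigned to neighbouring servers only, and no server receives more
than `b` requests. -/
def IsBMatching (G : Input) (b : ℕ) (M : G.Assignment) : Prop :=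
  (∀ (r : G.Request) (s : G.Server), M r = some s → s ∈ G.nbr r) ∧
    ∀ s : G.Server, G.load M s ≤ b

open Classical in
/-- The offline optimum: the largest size of a `b`-matching. -/
noncomputable def opt (G : Input) (b : ℕ) : ℕ :=
  (Finset.univ.filter fun M : G.Assignment => G.IsBMatching b M).sup G.size

end Input

/-- A deterministic online decision rule. On the arrival of a request, `decide n past current` is
the server that the request is matched to (`none`: it stays unmatched), as a function of the
number `n` of servers, the neighbourhoods `past` of the earlier requests in their order of
arrival, and the neighbourhood `current` of the new request. The earlier decisions
are themselves determined by `n` and `past`, so the rule may depend on them as well. -/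
structure OnlineAlgorithm where
  decide : (n : ℕ) → (past : List (Finset (Fin n))) → (current : Finset (Fin n)) → Option (Fin n)

namespace OnlineAlgorithm

/-- The assignment that the algorithm constructs on an input. -/
def output (A : OnlineAlgorithm) (G : Input) : G.Assignment :=
  fun r => A.decide G.numServers (G.arrivals.take r) (G.nbr r)

/-- The algorithm always constructs a feasible solution of the `b`-matching problem
on `(k,d)`-graphs. -/
def IsFeasible (A : OnlineAlgorithm) (k d b : ℕ) : Prop :=
  ∀ G : Input, G.IsKDGraph k d b → G.IsBMatching b (A.output G)

/-- The algorithm is `c`-competitive on `(k,d)`-graphs with uniform server capacity `b`. -/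
def IsCompetitive (A : OnlineAlgorithm) (k d b : ℕ) (c : ℝ) : Prop :=
  ∀ G : Input, G.IsKDGraph k d b → c * (G.opt b : ℝ) ≤ (G.size (A.output G) : ℝ)

end OnlineAlgorithm

/-- The ratio `c*`. -/
noncomputable def cStar (k d b : ℕ) : ℝ :=
  1 - 1 / (b : ℝ) *
    (∑ i ∈ Finset.Icc 1 b,
      (i : ℝ) * ((k * b).choose (b - i) : ℝ) * (1 / ((d : ℝ) - 1) ^ (b - i))) *
    (1 - 1 / (d : ℝ)) ^ (k * b)

end OnlineBMatching

/-! Put `K = k * b`. The adversary always offers a request to `d` servers of equal degree below `K`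
and equal load. At most one of them is matched, so the algorithm does no better than matching each
with probability `1 / d`. Accordingly the sum over all servers of the expected free capacity never
decreases (`totalPotential_le_concat`). The adversary stops when every class of equal degree below
`K` and equal load has fewer than `d` servers. At most `d * K ^ 2` servers then lack degree, however
large `n` is; singleton requests repair them (`exists_hard_input`). Since `d ≤ k`, Hall's theorem
gives optimum `n * b` (`Input.opt_eq`), and `n → ∞` removes the constant. -/

namespace OnlineBMatching

open Finset

/-! ### Expected free capacity under random matching -/

section Potential

/-- The expected free capacity `𝔼 (b - j - X)⁺`, where `X` is binomial with parameters `m` and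
`1 / d`: the free capacity that a server of load `j` keeps over `m` further requests, each of
which is matched to it with probability `1 / d`. -/
noncomputable def potential (d b m j : ℕ) : ℝ :=
  (1 - 1 / (d : ℝ)) ^ m *
    ∑ x ∈ range (b + 1), (m.choose x : ℝ) * (1 / ((d : ℝ) - 1)) ^ x * ((b - j - x : ℕ) : ℝ)

variable {d b : ℕ}

lemma potential_zero (j : ℕ) : potential d b 0 j = ((b - j : ℕ) : ℝ) := by
  unfold potential
  rw [sum_range_succ']
  simp

/-- Condition on the first request; algebraically this is Pascal's rule. -/
lemma potential_succ (hd : 2 ≤ d) (m j : ℕ) :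
    potential d b (m + 1) j =
      (1 - 1 / (d : ℝ)) * potential d b m j + 1 / (d : ℝ) * potential d b m (j + 1) := by
  have hd' : (2 : ℝ) ≤ d := by exact_mod_cast hd
  have h1 : (d : ℝ) - 1 ≠ 0 := by linarith
  have hu : (1 - 1 / (d : ℝ)) * (1 / ((d : ℝ) - 1)) = 1 / d := by
    have : (d : ℝ) ≠ 0 := by linarith
    field_simp
  unfold potential
  generalize 1 / ((d : ℝ) - 1) = u at *
  have key : ∑ x ∈ range (b + 1), ((m + 1).choose x : ℝ) * u ^ x * ((b - j - x : ℕ) : ℝ) =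
      ∑ x ∈ range (b + 1), (m.choose x : ℝ) * u ^ x * ((b - j - x : ℕ) : ℝ) +
      u * ∑ x ∈ range (b + 1), (m.choose x : ℝ) * u ^ x * ((b - (j + 1) - x : ℕ) : ℝ) := by
    rw [sum_range_succ', sum_range_succ' (fun x => (m.choose x : ℝ) * u ^ x * _),
      sum_range_succ (fun x => (m.choose x : ℝ) * u ^ x * ((b - (j + 1) - x : ℕ) : ℝ))]
    -- The shift `x ↦ x + 1` misses the term `x = b`, which truncated subtraction makes zero.
    have hlast : b - (j + 1) - b = 0 := by omega
    have hterm : ∀ x ∈ range b,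
        ((m + 1).choose (x + 1) : ℝ) * u ^ (x + 1) * ((b - j - (x + 1) : ℕ) : ℝ) =
        (m.choose (x + 1) : ℝ) * u ^ (x + 1) * ((b - j - (x + 1) : ℕ) : ℝ) +
        u * ((m.choose x : ℝ) * u ^ x * ((b - (j + 1) - x : ℕ) : ℝ)) := by
      intro x _
      rw [Nat.choose_succ_succ, show b - (j + 1) - x = b - j - (x + 1) by omega]
      push_cast
      ring
    rw [sum_congr rfl hterm, sum_add_distrib, hlast, ← mul_sum]
    simp
    ring
  rw [key]
  generalize ∑ x ∈ range (b + 1), (m.choose x : ℝ) * u ^ x * ((b - (j + 1) - x : ℕ) : ℝ) = S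
  linear_combination (1 - 1 / (d : ℝ)) ^ m * S * hu

lemma potential_antitone (hd : 2 ≤ d) (m : ℕ) : Antitone (potential d b m) := by
  intro i j hij
  have hd' : (2 : ℝ) ≤ d := by exact_mod_cast hd
  have h0 : 0 ≤ 1 - 1 / (d : ℝ) := by
    rw [sub_nonneg, div_le_one (by linarith)]
    linarith
  have h1 : 0 ≤ 1 / ((d : ℝ) - 1) := one_div_nonneg.2 (by linarith)
  unfold potential
  gcongr

lemma potential_le (hd : 2 ≤ d) (m j : ℕ) : potential d b m j ≤ b := by
  induction m with
  | zero =>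
    rw [potential_zero]
    exact_mod_cast Nat.sub_le b j
  | succ m ih =>
    rw [potential_succ hd]
    have h := mul_le_mul_of_nonneg_left (potential_antitone (b := b) hd m (Nat.le_succ j))
      (show (0 : ℝ) ≤ 1 / (d : ℝ) by positivity)
    simp only [Nat.succ_eq_add_one] at h
    linarith

/-- Substitute `i = b - x`; the term `x = b` vanishes. -/
lemma cStar_eq (k : ℕ) :
    cStar k d b = 1 - 1 / (b : ℝ) * potential d b (k * b) 0 := by
  unfold cStar potential
  have hsum : ∑ i ∈ Icc 1 b,
      (i : ℝ) * ((k * b).choose (b - i) : ℝ) * (1 / ((d : ℝ) - 1) ^ (b - i)) =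
      ∑ x ∈ range (b + 1),
        ((k * b).choose x : ℝ) * (1 / ((d : ℝ) - 1)) ^ x * ((b - 0 - x : ℕ) : ℝ) := by
    rw [← sum_range_reflect, sum_range_succ', ← Ico_add_one_right_eq_Icc, sum_Ico_eq_sum_range]
    simp only [Nat.add_sub_cancel, Nat.sub_self, Nat.sub_zero, Nat.cast_zero, mul_zero, add_zero]
    refine sum_congr rfl fun x hx => ?_
    have hx' := mem_range.1 hx
    rw [show b - (b - (x + 1)) = x + 1 by omega, add_comm 1 x, one_div_pow]
    ring
  rw [hsum]
  ring

end Potential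

/-! ### The offline optimum -/

section Offline

variable {k d b : ℕ}

lemma Input.size_eq_sum_load (G : Input) (M : G.Assignment) : G.size M = ∑ s, G.load M s := by
  unfold Input.size Input.load
  rw [card_eq_sum_card_fiberwise (f := M) (t := univ.map Function.Embedding.some)]
  · rw [sum_map]
    refine sum_congr rfl fun s _ => ?_
    congr 1
    ext r
    simp +contextual
  · intro r hr
    simpa [Option.ne_none_iff_exists] using hr

lemma Input.size_le (G : Input) {M : G.Assignment} (hM : G.IsBMatching b M) :
    G.size M ≤ G.numServers * b := by
  rw [G.size_eq_sum_load]
  calc ∑ s, G.load M s ≤ ∑ _s : G.Server, b := sum_le_sum fun s _ => hM.2 s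
    _ = G.numServers * b := by simp

/-- If `d ≤ k`, then Hall's condition holds for the graph with `b` copies of every server. -/
lemma Input.exists_injective (G : Input) (hG : G.IsKDGraph k d b) (hd : 2 ≤ d) (hkd : d ≤ k) :
    ∃ f : G.Server × Fin b → G.Request, Function.Injective f ∧ ∀ p, p.1 ∈ G.nbr (f p) := by
  classical
  let N : G.Server × Fin b → Finset G.Request := fun p => univ.filter fun r => p.1 ∈ G.nbr r
  obtain ⟨f, hf, hfN⟩ := (all_card_le_biUnion_card_iff_exists_injective N).1 (by
    intro X
    have h1 : X.card ≤ (X.image Prod.fst).card * b := by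
      calc X.card ≤ (X.image Prod.fst ×ˢ (univ : Finset (Fin b))).card :=
            card_le_card fun p hp => by
              simp only [mem_product, mem_image, mem_univ, and_true]
              exact ⟨p, hp, rfl⟩
        _ = (X.image Prod.fst).card * b := by simp
    -- Double count the edges at the servers occurring in `X`.
    have h2 : (X.image Prod.fst).card * (k * b) ≤ (X.biUnion N).card * d := by
      refine card_mul_le_card_mul (fun s r => s ∈ G.nbr r) (fun s hs => ?_) fun r _ => ?_
      · refine (hG.1 s).trans (card_le_card fun r hr => ?_)
        obtain ⟨p, hp, rfl⟩ := mem_image.1 hs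
        have hr' := (mem_filter.1 hr).2
        simp only [mem_bipartiteAbove, mem_biUnion]
        exact ⟨⟨p, hp, mem_filter.2 ⟨mem_univ _, hr'⟩⟩, hr'⟩
      · refine le_trans (card_le_card fun s hs => ?_) (hG.2 r)
        exact (mem_bipartiteBelow _ |>.1 hs).2
    have h3 : (X.image Prod.fst).card * b * d ≤ (X.image Prod.fst).card * (k * b) := by
      rw [mul_assoc, mul_comm b d]
      gcongr
    exact h1.trans (Nat.le_of_mul_le_mul_right (h3.trans h2) (by omega)))
  exact ⟨f, hf, fun p => (mem_filter.1 (hfN p)).2⟩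

lemma Input.opt_eq (G : Input) (hG : G.IsKDGraph k d b) (hd : 2 ≤ d) (hkd : d ≤ k) :
    G.opt b = G.numServers * b := by
  classical
  obtain ⟨f, hf, hfN⟩ := G.exists_injective hG hd hkd
  refine le_antisymm (Finset.sup_le fun M hM => G.size_le (mem_filter.1 hM).2) ?_
  let M : G.Assignment := Function.extend f (fun p => some p.1) fun _ => none
  have hMf : ∀ p, M (f p) = some p.1 := fun p => hf.extend_apply _ _ p
  have hMr : ∀ r s, M r = some s → ∃ i, f (s, i) = r := by
    intro r s h
    by_cases hr : ∃ p, f p = r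
    · obtain ⟨⟨s', i⟩, rfl⟩ := hr
      rw [hMf] at h
      cases h
      exact ⟨i, rfl⟩
    · have : M r = none := Function.extend_apply' _ _ _ hr
      simp [this] at h
  have hM : G.IsBMatching b M := by
    refine ⟨fun r s h => ?_, fun s => ?_⟩
    · obtain ⟨i, rfl⟩ := hMr r s h
      exact hfN (s, i)
    · calc G.load M s ≤ (univ.image fun i : Fin b => f (s, i)).card :=
            card_le_card fun r hr => by
              obtain ⟨i, hi⟩ := hMr r s (mem_filter.1 hr).2
              exact mem_image.2 ⟨i, mem_univ _, hi⟩
        _ ≤ b := by simpa using card_image_le (s := (univ : Finset (Fin b)))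
  have hsize : G.numServers * b ≤ G.size M := by
    calc G.numServers * b = (univ.image f).card := by
          rw [card_image_of_injective _ hf]
          simp
      _ ≤ G.size M := card_le_card fun r hr => by
          obtain ⟨p, _, rfl⟩ := mem_image.1 hr
          simp [hMf]
  exact hsize.trans (Finset.le_sup (f := G.size) (mem_filter.2 ⟨mem_univ _, hM⟩))

end Offline

/-! ### The adversary -/

section Adversary

variable {k d b n : ℕ}

/-- The number of requests in `L` that are adjacent to the server `s`. -/
def degreeIn (L : List (Finset (Fin n))) (s : Fin n) : ℕ := L.countP (s ∈ ·)

/-- The number of requests in `L` that are adjacent to the server `s` and that the algorithm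
assigns to `s`. -/
def loadIn (A : OnlineAlgorithm) (L : List (Finset (Fin n))) (s : Fin n) : ℕ :=
  ∑ i ∈ range L.length,
    -- On a prefix that is not yet a `(k,d)`-graph the rule may name a non-neighbour; the membership
    -- test discards it. The default `∅` is never reached.
    if A.decide n (L.take i) (L.getD i ∅) = some s ∧ s ∈ L.getD i ∅ then 1 else 0

lemma degreeIn_concat (L : List (Finset (Fin n))) (T : Finset (Fin n)) (s : Fin n) :
    degreeIn (L ++ [T]) s = degreeIn L s + if s ∈ T then 1 else 0 := by
  simp [degreeIn, List.countP_append, List.countP_cons]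

lemma loadIn_concat (A : OnlineAlgorithm) (L : List (Finset (Fin n))) (T : Finset (Fin n))
    (s : Fin n) :
    loadIn A (L ++ [T]) s = loadIn A L s + if A.decide n L T = some s ∧ s ∈ T then 1 else 0 := by
  unfold loadIn
  rw [List.length_append, List.length_singleton, sum_range_succ]
  congr 1
  · refine sum_congr rfl fun i hi => ?_
    have hi' := mem_range.1 hi
    rw [List.take_append_of_le_length hi'.le, List.getD_append _ _ _ _ hi']
  · simp

lemma loadIn_append_of_notMem (A : OnlineAlgorithm) (L F : List (Finset (Fin n))) (s : Fin n)
    (hF : ∀ T ∈ F, s ∉ T) : loadIn A (L ++ F) s = loadIn A L s := by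
  induction F generalizing L with
  | nil => simp
  | cons T F ih =>
    rw [← List.singleton_append, ← List.append_assoc,
      ih _ fun T' hT' => hF T' (List.mem_cons_of_mem _ hT'), loadIn_concat]
    simp [hF T]

lemma loadIn_le_degreeIn (A : OnlineAlgorithm) (L : List (Finset (Fin n))) (s : Fin n) :
    loadIn A L s ≤ degreeIn L s := by
  induction L using List.reverseRecOn with
  | nil => simp [loadIn]
  | append_singleton L T ih =>
    rw [loadIn_concat, degreeIn_concat]
    split_ifs <;> first | omega | tauto

lemma serverDegree_mk (L : List (Finset (Fin n))) (s : Fin n) :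
    (Input.mk n L).serverDegree s = degreeIn L s := by
  unfold Input.serverDegree Input.nbr degreeIn
  induction L with
  | nil => rfl
  | cons T L ih =>
    rw [List.countP_cons, ← ih]
    refine (Fin.card_filter_univ_succ' _).trans ?_
    rw [add_comm]
    by_cases hs : s ∈ T <;> simp [hs]

lemma load_mk (A : OnlineAlgorithm) (L : List (Finset (Fin n)))
    (h : (Input.mk n L).IsBMatching b (A.output ⟨n, L⟩)) (s : Fin n) :
    (Input.mk n L).load (A.output ⟨n, L⟩) s = loadIn A L s := by
  unfold Input.load loadIn
  rw [card_filter, ← Fin.sum_univ_eq_sum_range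
    (fun i => if A.decide n (L.take i) (L.getD i ∅) = some s ∧ s ∈ L.getD i ∅ then 1 else 0)]
  refine sum_congr rfl fun r _ => ?_
  have hr : L.getD r ∅ = (Input.mk n L).nbr r := by simp [Input.nbr]
  have hr' : A.output ⟨n, L⟩ r = A.decide n (L.take r) ((Input.mk n L).nbr r) := rfl
  have := h.1 r s
  rw [hr'] at this ⊢
  rw [hr]
  by_cases hs : A.decide n (L.take r) ((Input.mk n L).nbr r) = some s
  · simp [hs, this hs]
  · simp [hs]

/-- The total potential of the servers after the requests `L`, if every server receives `K`
requests in total. -/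
noncomputable def totalPotential (A : OnlineAlgorithm) (d b K : ℕ) (L : List (Finset (Fin n))) :
    ℝ :=
  ∑ s, potential d b (K - degreeIn L s) (loadIn A L s)

/-- A request to `d` servers that agree in degree and load does not decrease the potential. -/
lemma totalPotential_le_concat (A : OnlineAlgorithm) (hd : 2 ≤ d) {K t j : ℕ} (ht : t < K)
    (L : List (Finset (Fin n))) (T : Finset (Fin n)) (hT : T.card = d)
    (hTs : ∀ s ∈ T, degreeIn L s = t ∧ loadIn A L s = j) :
    totalPotential A d b K L ≤ totalPotential A d b K (L ++ [T]) := by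
  have hd' : (2 : ℝ) ≤ d := by exact_mod_cast hd
  unfold totalPotential
  rw [← sum_add_sum_compl T, ← sum_add_sum_compl T (fun s => potential d b _ (loadIn A (L ++ _) s))]
  refine add_le_add ?_ (le_of_eq (sum_congr rfl fun s hs => ?_))
  swap
  · rw [degreeIn_concat, loadIn_concat]
    simp [mem_compl.1 hs]
  obtain ⟨m, hm⟩ : ∃ m, K - t = m + 1 := ⟨K - t - 1, by omega⟩
  have hm' : K - (t + 1) = m := by omega
  -- By the recurrence, the old potential of `T` is its new potential in the case that exactly one
  -- server of `T` is matched.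
  have hleft : ∑ s ∈ T, potential d b (K - degreeIn L s) (loadIn A L s) =
      ((d : ℝ) - 1) * potential d b m j + potential d b m (j + 1) := by
    rw [sum_congr rfl fun s hs => by rw [(hTs s hs).1, (hTs s hs).2, hm], sum_const, hT,
      potential_succ hd, nsmul_eq_mul]
    have : (d : ℝ) ≠ 0 := by linarith
    field_simp
  have hanti := potential_antitone (b := b) hd m (Nat.le_succ j)
  have hright : ∀ s ∈ T, potential d b (K - degreeIn (L ++ [T]) s) (loadIn A (L ++ [T]) s) =
      potential d b m j - if A.decide n L T = some s then
        potential d b m j - potential d b m (j + 1) else 0 := by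
    intro s hs
    rw [degreeIn_concat, loadIn_concat, (hTs s hs).1, (hTs s hs).2]
    by_cases h : A.decide n L T = some s <;> simp [hs, h, hm']
  rw [hleft, sum_congr rfl hright, sum_sub_distrib, sum_const, hT, nsmul_eq_mul]
  -- At most one server of `T` incurs the drop.
  have hone : (∑ s ∈ T, if A.decide n L T = some s then
      potential d b m j - potential d b m (j + 1) else 0) ≤
      potential d b m j - potential d b m (j + 1) := by
    have hnn : 0 ≤ potential d b m j - potential d b m (j + 1) := sub_nonneg.2 hanti
    cases h : A.decide n L T with
    | none => simpa using hnn
    | some s₀ =>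
      simp only [Option.some.injEq, sum_ite_eq]
      split_ifs <;> linarith
  linarith

/-- The adversary can go on until, for every degree `t < K` and every load `j`, fewer than `d`
servers have degree `t` and load `j`. -/
lemma exists_saturated (A : OnlineAlgorithm) (hd : 2 ≤ d) (n K : ℕ) :
    ∃ L : List (Finset (Fin n)), (∀ T ∈ L, T.card ≤ d) ∧
      n * potential d b K 0 ≤ totalPotential A d b K L ∧
      ∀ t < K, ∀ j, (univ.filter fun s => degreeIn L s = t ∧ loadIn A L s = j).card < d := by
  -- Termination: each request lowers the total missing degree `m`.
  suffices H : ∀ (m : ℕ) (L : List (Finset (Fin n))), ∑ s, (K - degreeIn L s) = m →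
      (∀ T ∈ L, T.card ≤ d) → n * potential d b K 0 ≤ totalPotential A d b K L →
      ∃ L : List (Finset (Fin n)), (∀ T ∈ L, T.card ≤ d) ∧
        n * potential d b K 0 ≤ totalPotential A d b K L ∧
        ∀ t < K, ∀ j, (univ.filter fun s => degreeIn L s = t ∧ loadIn A L s = j).card < d from
    H _ [] rfl (by simp) (by simp [totalPotential, degreeIn, loadIn])
  intro m
  induction m using Nat.strong_induction_on with
  | _ m ih =>
    intro L hm hL hpot
    by_cases hsat :
        ∀ t < K, ∀ j, (univ.filter fun s => degreeIn L s = t ∧ loadIn A L s = j).card < d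
    · exact ⟨L, hL, hpot, hsat⟩
    push Not at hsat
    obtain ⟨t, ht, j, hcard⟩ := hsat
    obtain ⟨T, hTsub, hT⟩ := exists_subset_card_eq hcard
    have hTs : ∀ s ∈ T, degreeIn L s = t ∧ loadIn A L s = j :=
      fun s hs => (mem_filter.1 (hTsub hs)).2
    refine ih _ ?_ (L ++ [T]) rfl ?_ (hpot.trans (totalPotential_le_concat A hd ht L T hT hTs))
    · rw [← hm]
      obtain ⟨s, hs⟩ := card_pos.1 (show 0 < T.card by omega)
      refine sum_lt_sum (fun s _ => ?_) ⟨s, mem_univ s, ?_⟩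
      · rw [degreeIn_concat]
        omega
      · rw [degreeIn_concat, if_pos hs, (hTs s hs).1]
        omega
    · intro T' hT'
      rcases List.mem_append.1 hT' with h | h
      · exact hL T' h
      · rw [List.mem_singleton.1 h, hT]

/-- Singleton requests that raise the degree of every server in `U` by at least `K`. -/
lemma exists_singletons (K : ℕ) (U : Finset (Fin n)) :
    ∃ F : List (Finset (Fin n)), (∀ T ∈ F, T.card ≤ 1 ∧ T ⊆ U) ∧ ∀ s ∈ U, K ≤ degreeIn F s := by
  induction U using Finset.induction_on with
  | empty => exact ⟨[], by simp, by simp⟩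
  | insert u U hu ih =>
    obtain ⟨F, hF, hdeg⟩ := ih
    refine ⟨List.replicate K {u} ++ F, fun T hT => ?_, fun s hs => ?_⟩
    · rcases List.mem_append.1 hT with h | h
      · rw [List.eq_of_mem_replicate h]
        simp
      · exact ⟨(hF T h).1, (hF T h).2.trans (subset_insert u U)⟩
    · rw [degreeIn, List.countP_append]
      rcases mem_insert.1 hs with rfl | h
      · simp [List.countP_replicate]
      · exact (hdeg s h).trans (Nat.le_add_left _ _)

/-- Load is at most degree, so at most `K * K` classes have degree below `K`. -/
lemma card_unsaturated_le (A : OnlineAlgorithm) (K : ℕ) (L : List (Finset (Fin n)))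
    (hsat : ∀ t < K, ∀ j,
      (univ.filter fun s => degreeIn L s = t ∧ loadIn A L s = j).card < d) :
    (univ.filter fun s => degreeIn L s < K).card ≤ d * (K * K) := by
  have h := card_le_mul_card_image_of_maps_to (s := univ.filter fun s => degreeIn L s < K)
    (t := range K ×ˢ range K) (f := fun s => (degreeIn L s, loadIn A L s)) (fun s hs => by
      have h1 := (mem_filter.1 hs).2
      have h2 := loadIn_le_degreeIn A L s
      simp only [mem_product, mem_range]
      omega) d (fun p hp => by
      refine le_trans (card_le_card fun s hs => ?_)
        (hsat p.1 (mem_range.1 (mem_product.1 hp).1) p.2).le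
      have := (mem_filter.1 hs).2
      simp [← this])
  simpa using h

/-- On every number `n` of servers there is an input on which the algorithm leaves, up to a
constant, at least `n * potential d b (k * b) 0` of the capacity unused. -/
lemma exists_hard_input (A : OnlineAlgorithm) (hA : A.IsFeasible k d b) (hd : 2 ≤ d) (n : ℕ) :
    ∃ G : Input, G.IsKDGraph k d b ∧ G.numServers = n ∧
      (G.size (A.output G) : ℝ) ≤
        n * b - n * potential d b (k * b) 0 + (d * (k * b * (k * b)) : ℕ) * b := by
  obtain ⟨L, hL, hpot, hsat⟩ := exists_saturated (b := b) A hd n (k * b)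
  set U : Finset (Fin n) := univ.filter fun s => degreeIn L s < k * b with hU
  have hUcard : U.card ≤ d * (k * b * (k * b)) := card_unsaturated_le A (k * b) L hsat
  obtain ⟨F, hF, hFdeg⟩ := exists_singletons (k * b) U
  have hG : (Input.mk n (L ++ F)).IsKDGraph k d b := by
    refine ⟨fun s => ?_, fun r => ?_⟩
    · rw [serverDegree_mk, degreeIn, List.countP_append]
      by_cases hs : s ∈ U
      · exact (hFdeg s hs).trans (Nat.le_add_left _ _)
      · have : k * b ≤ degreeIn L s := by simpa [hU] using hs
        exact this.trans (Nat.le_add_right _ _)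
    · rcases List.mem_append.1 (List.get_mem (L ++ F) r) with h | h
      · exact hL _ h
      · exact (hF _ h).1.trans (by omega)
  have hM := hA _ hG
  refine ⟨⟨n, L ++ F⟩, hG, rfl, ?_⟩
  rw [Input.size_eq_sum_load]
  -- Outside `U` no request is outstanding and the potential is exactly the free capacity. On `U`
  -- the extra `b` makes the bound trivial, as the potential is at most `b`.
  have hserver : ∀ s : Fin n,
      ((Input.mk n (L ++ F)).load (A.output ⟨n, L ++ F⟩) s : ℝ) ≤
        b - potential d b (k * b - degreeIn L s) (loadIn A L s) + if s ∈ U then (b : ℝ) else 0 := by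
    intro s
    have hload : ((Input.mk n (L ++ F)).load (A.output ⟨n, L ++ F⟩) s) ≤ b := hM.2 s
    by_cases hs : s ∈ U
    · have := potential_le (b := b) hd (k * b - degreeIn L s) (loadIn A L s)
      have hload' : ((Input.mk n (L ++ F)).load (A.output ⟨n, L ++ F⟩) s : ℝ) ≤ b := by
        exact_mod_cast hload
      rw [if_pos hs]
      linarith
    · have hdeg : k * b - degreeIn L s = 0 := by
        have : k * b ≤ degreeIn L s := by simpa [hU] using hs
        omega
      -- The singletons avoid `s`, so its load after `L` is final. Feasibility bounds it by `b`, so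
      -- `b - load` is not truncated.
      rw [load_mk A _ hM, loadIn_append_of_notMem A L F s fun T hT h =>
        hs ((hF T hT).2 h)] at hload ⊢
      rw [hdeg, potential_zero, if_neg hs, Nat.cast_sub hload]
      linarith
  have hsum : ((∑ s : Fin n, (Input.mk n (L ++ F)).load (A.output ⟨n, L ++ F⟩) s : ℕ) : ℝ) ≤
      n * b - totalPotential A d b (k * b) L + U.card * b := by
    push_cast
    refine (sum_le_sum fun s _ => hserver s).trans (le_of_eq ?_)
    simp [sum_add_distrib, sum_sub_distrib, totalPotential]
  have hUb : (U.card : ℝ) * b ≤ (d * (k * b * (k * b)) : ℕ) * b := by gcongr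
  exact hsum.trans (by linarith)

end Adversary

end OnlineBMatching

theorem mainTheorem2 (k d b : ℕ) (hd : 2 ≤ d) (hkd : d ≤ k) (hb : 1 ≤ b)
    (A : OnlineBMatching.OnlineAlgorithm) (hA : A.IsFeasible k d b)
    (c : ℝ) (hc : A.IsCompetitive k d b c) :
    c ≤ OnlineBMatching.cStar k d b := by
  have hb' : (0 : ℝ) < b := by exact_mod_cast hb
  rw [OnlineBMatching.cStar_eq k]
  set p := OnlineBMatching.potential d b (k * b) 0 with hp
  set C : ℝ := (d * (k * b * (k * b)) : ℕ) * b with hC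
  -- As `C` does not depend on `n`, the slope in `n` cannot be positive.
  have hbound : ∀ n : ℕ, n * (c * b - b + p) ≤ C := by
    intro n
    obtain ⟨G, hG, hn, hsize⟩ := OnlineBMatching.exists_hard_input A hA hd n
    have hcomp := hc G hG
    rw [G.opt_eq hG hd hkd, hn] at hcomp
    push_cast at hcomp
    linarith
  have hle : c * b - b + p ≤ 0 := by
    by_contra! hpos
    obtain ⟨n, hn⟩ := exists_nat_gt (C / (c * b - b + p))
    rw [div_lt_iff₀ hpos] at hn
    linarith [hbound n]
  have : c * b ≤ (1 - 1 / (b : ℝ) * p) * b := by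
    field_simp
    linarith
  exact le_of_mul_le_mul_right this hb'
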